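/- Let $\mathbb B$ be a complete Boolean algebra. For a sequence $x=\langle x_n:n\in\omega\rangle$ in $\mathbb B$ put $\limsup x=\bigwedge_{k}\bigvee_{n\ge k}x_n$ and $\liminf x=\bigvee_{k}\bigwedge_{n\ge k}x_n$. A convergence on a set $X$ is a map $\lambda:X^\omega\to P(X)$; it is called topological if there is a topology on $X$ such that, for every sequence $x\in X^\omega$, $\lambda(x)$ is exactly the set of all limit points of $x$ in that topology, that is, of all $a\in X$ each of whose neighbourhoods contains all but finitely many members of $x$. Let $\lambda_{\mathrm{ls}}$ and $\lambda_{\mathrm{li}}$ be the convergences on $\mathbb B$ defined by $$\lambda_{\mathrm{ls}}(x)=\{b\in\mathbb B:\limsup x\le b\},\qquad \lambda_{\mathrm{li}}(x)=\{b\in\mathbb B: b\le\liminf x\}.$$ Then the following conditions are equivalent: (a) $\lambda_{\mathrm{ls}}$ is a topological convergence; (b) $\lambda_{\mathrm{li}}$ is a topological convergence; (c) $\mathbb B$ is $(\omega,2)$-distributive, that is, $\bigwedge_{n\in\omega}\bigvee_{i<2}a_{n,i}=\bigvee_{f:\omega\to 2}\bigwedge_{n\in\omega}a_{n,f(n)}$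 for every family $\langle a_{n,i}:n\in\omega,\ i<2\rangle$ in $\mathbb B$; (d) forcing by $\mathbb B$ does not produce new reals, that is, in the Boolean-valued universe $V^{\mathbb B}$ the statement "every subset of $\omega$ belongs to the ground model $V$" has Boolean value $1$. -/

import Mathlib

/-!
Complementation exchanges `limsup` and `liminf`, which gives (a) ⇔ (b). For the rest,
distributivity is used in the form: for every sequence `a`, the meets `⋀ n, ± a n` over all choices
of signs have join `⊤`.

If `x` converges to `a` in the lower topology, then `limsup x ≤ a` holds below every element that
decides all of `x`, so in a distributive algebra `limsup x ≤ a`. Conversely, enumerate the nodes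
of the binary tree of decisions about `a`. Each level joins to `⊤`, so the limsup is `⊤`. By
compactness of `2^ω`, every subsequence has a further one whose nodes converge to a branch, hence
whose limsup lies below the meet of that branch. A topological convergence passes from
subsequences to the whole sequence, so the join of the meets of all branches is at least `⊤`.

For (d), a name `x` for a subset of `ω` is determined by the sequence of values `‖n ∈ x‖`, every
sequence arises in this way, and `x` equals a given ground model set `S` with value
`⋀ n, ± ‖n ∈ x‖`, where the signs are those of the characteristic function of `S`.
-/

universe u

/-- A convergence on `X`: a map assigning to each sequence in `X` its set of limits. -/
abbrev Convergence (X : Type u) : Type u := (ℕ → X) → Set X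

/-- The convergence determined by a topology: `a` is a limit of `x` when every neighbourhood of `a`
contains all but finitely many members of `x`. -/
def topologyLim {X : Type u} (t : TopologicalSpace X) : Convergence X :=
  fun x => {a | Filter.Tendsto x Filter.atTop (@nhds X t a)}

/-- A convergence is topological when it is the convergence determined by some topology. -/
def Convergence.IsTopological {X : Type u} (c : Convergence X) : Prop :=
  ∃ t : TopologicalSpace X, c = topologyLim t

/-- The convergence `x ↦ (limsup x)↑`. -/
def convLs (B : Type u) [CompleteBooleanAlgebra B] : Convergence B :=
  fun x => Set.Ici (Filter.limsup x Filter.atTop)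

/-- The convergence `x ↦ (liminf x)↓`. -/
def convLi (B : Type u) [CompleteBooleanAlgebra B] : Convergence B :=
  fun x => Set.Iic (Filter.liminf x Filter.atTop)

/-- `(ω, 2)`-distributivity: `⋀ₙ ⋁ᵢ aₙᵢ = ⋁_{f : ω → 2} ⋀ₙ a_{n, f n}`. -/
def IsOmegaTwoDistributive (B : Type u) [CompleteBooleanAlgebra B] : Prop :=
  ∀ a : ℕ → Fin 2 → B, (⨅ n, ⨆ i, a n i) = ⨆ f : ℕ → Fin 2, ⨅ n, a n (f n)

/-- The class `V^B` of `B`-names: a name is a family of names, each with a value in `B`. -/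
inductive BName (B : Type u) : Type (u + 1)
  | mk (ι : Type u) (elt : ι → BName B) (val : ι → B) : BName B

namespace BName

variable {B : Type u}

/-- The canonical name of a set of the ground universe. -/
def check [Top B] : PSet.{u} → BName B
  | ⟨ι, A⟩ => ⟨ι, fun i => check (A i), fun _ => ⊤⟩

variable [CompleteBooleanAlgebra B]

/-- The Boolean value `‖x = y‖`, that is, of `(∀ s ∈ x, ∃ t ∈ y, s = t) ∧ (∀ t ∈ y, ∃ s ∈ x, s = t)`. -/
def eqVal : BName B → BName B → B
  | ⟨_, x, b⟩, ⟨_, y, c⟩ =>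
    (⨅ i, b i ⇨ ⨆ j, c j ⊓ eqVal (x i) (y j)) ⊓ (⨅ j, c j ⇨ ⨆ i, b i ⊓ eqVal (x i) (y j))

/-- The Boolean value `‖x ∈ y‖`. -/
def memVal (x : BName B) : BName B → B
  | ⟨_, y, c⟩ => ⨆ j, c j ⊓ eqVal x (y j)

/-- The Boolean value `‖x ⊆ y‖`. -/
def subsetVal : BName B → BName B → B
  | ⟨_, x, b⟩, y => ⨅ i, b i ⇨ memVal (x i) y

/-- The Boolean value `‖x ∈ V‖`, where `V` is the ground universe. -/
def groundVal (x : BName B) : B :=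
  ⨆ y : PSet.{u}, eqVal x (check y)

end BName

/-- Forcing by `B` produces no new reals: in the Boolean-valued universe `V^B` it is true (has
value `⊤`) that every subset of `ω` belongs to the ground universe. -/
def ForcingAddsNoNewReals (B : Type u) [CompleteBooleanAlgebra B] : Prop :=
  (⨅ x : BName B, BName.subsetVal x (BName.check PSet.omega) ⇨ BName.groundVal x) = ⊤

open Filter Topology

namespace Convergence

variable {X : Type*} {c : Convergence X}

theorem IsTopological.induced {Y : Type*} {d : Convergence Y} (hd : d.IsTopological) (f : X → Y)
    (h : ∀ x a, a ∈ c x ↔ f a ∈ d (f ∘ x)) : c.IsTopological := by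
  obtain ⟨t, rfl⟩ := hd
  refine ⟨t.induced f, funext fun x => Set.ext fun a => (h x a).trans ?_⟩
  simp only [topologyLim, Set.mem_ofPred_eq, nhds_induced, tendsto_comap_iff]

theorem IsTopological.mem_of_forall_subseq (hc : c.IsTopological) {x : ℕ → X} {a : X}
    (h : ∀ ns : ℕ → ℕ, Tendsto ns atTop atTop → ∃ φ : ℕ → ℕ, a ∈ c (x ∘ ns ∘ φ)) : a ∈ c x := by
  obtain ⟨t, rfl⟩ := hc
  exact tendsto_of_subseq_tendsto h

end Convergence

section Duality

variable {B : Type*} [CompleteBooleanAlgebra B]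

theorem mem_convLs_iff_compl_mem_convLi (x : ℕ → B) (a : B) :
    a ∈ convLs B x ↔ aᶜ ∈ convLi B (compl ∘ x) := by
  simp only [convLs, convLi, Set.mem_Ici, Set.mem_Iic, ← limsup_compl, compl_le_compl_iff_le]

theorem mem_convLi_iff_compl_mem_convLs (x : ℕ → B) (a : B) :
    a ∈ convLi B x ↔ aᶜ ∈ convLs B (compl ∘ x) := by
  simp only [convLs, convLi, Set.mem_Ici, Set.mem_Iic, ← liminf_compl, compl_le_compl_iff_le]

theorem convLs_isTopological_iff_convLi_isTopological :
    (convLs B).IsTopological ↔ (convLi B).IsTopological :=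
  ⟨fun h => h.induced compl mem_convLi_iff_compl_mem_convLs,
    fun h => h.induced compl mem_convLs_iff_compl_mem_convLi⟩

end Duality

section Literal

/-- The literal of `a` with sign `t`: `a` itself if `t` is true, its complement otherwise. A meet
of literals of the terms of a sequence is a decision about which of these terms hold. -/
def literal {B : Type*} [Compl B] (a : B) (t : Bool) : B := bif t then a else aᶜ

theorem iSup_literal {B : Type*} [CompleteBooleanAlgebra B] (a : B) : ⨆ t, literal a t = ⊤ := by
  simp only [literal, iSup_bool_eq, cond_true, cond_false, sup_compl_eq_top]

variable {B : Type*} [CompleteBooleanAlgebra B]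

theorem iSup_inf_literal_le (a : Fin 2 → B) (t : Bool) :
    (⨆ i, a i) ⊓ literal (a 1) t ≤ a (finTwoEquiv.symm t) := by
  rw [← finTwoEquiv.symm.iSup_comp, iSup_bool_eq]
  cases t
  · exact (inf_sup_right _ _ _).le.trans
      (sup_le ((inf_compl_self _).le.trans bot_le) inf_le_left)
  · exact inf_le_right

theorem isOmegaTwoDistributive_iff_iSup_iInf_literal :
    IsOmegaTwoDistributive B ↔
      ∀ a : ℕ → B, ⨆ f : ℕ → Bool, ⨅ n, literal (a n) (f n) = ⊤ := by
  constructor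
  · intro h a
    have hlit := h fun n i => literal (a n) (finTwoEquiv i)
    simp only [finTwoEquiv.iSup_comp, iSup_literal, iInf_top] at hlit
    rw [hlit, ← (Equiv.piCongrRight fun _ : ℕ => finTwoEquiv).iSup_comp]
    rfl
  · intro h a
    refine le_antisymm ?_ (iSup_le fun f => iInf_mono fun n => le_iSup (a n) (f n))
    calc ⨅ n, ⨆ i, a n i
      _ = ⨆ f : ℕ → Bool, (⨅ n, ⨆ i, a n i) ⊓ ⨅ n, literal (a n 1) (f n) := by
        rw [← inf_iSup_eq, h, inf_top_eq]
      _ ≤ ⨆ f : ℕ → Fin 2, ⨅ n, a n (f n) := iSup_le fun f =>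
        le_iSup_of_le (fun n => finTwoEquiv.symm (f n)) <| le_iInf fun n =>
          (inf_le_inf (iInf_le _ n) (iInf_le _ n)).trans (iSup_inf_literal_le (a n) (f n))

theorem iSup_biInf_lt_literal (a : ℕ → B) (k : ℕ) :
    ⨆ g : ℕ → Bool, ⨅ i < k, literal (a i) (g i) = ⊤ := by
  have hdistrib := (Set.finite_Iio k).biInf_iSup_eq (f := fun i t => literal (a i) t)
  simpa only [iSup_literal, iInf_top, Set.mem_Iio] using hdistrib.symm

end Literal

section LowerTopology

theorem tendsto_nhds_of_limsup_le {ι α : Type*} [CompleteLattice α] [TopologicalSpace α]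
    [Topology.IsLower α] {l : Filter ι} {x : ι → α} {a : α} (h : limsup x l ≤ a) :
    Tendsto x l (𝓝 a) := by
  refine Topology.IsLower.tendsto_nhds_iff_not_le.2 fun c hca => ?_
  contrapose! hca
  exact (le_limsup_of_frequently_le' hca).trans h

variable {B : Type*} [CompleteBooleanAlgebra B]

theorem limsup_inf_iInf_literal_le_of_tendsto_nhds {ι : Type*} [TopologicalSpace B]
    [Topology.IsLower B] {l : Filter ι} {x : ι → B} {a : B} (h : Tendsto x l (𝓝 a))
    (f : ι → Bool) : limsup x l ⊓ ⨅ i, literal (x i) (f i) ≤ a := by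
  set c := limsup x l ⊓ ⨅ i, literal (x i) (f i)
  by_contra hca
  have hdisj : ∀ᶠ i in l, x i ≤ cᶜ := by
    filter_upwards [Topology.IsLower.tendsto_nhds_iff_not_le.1 h c hca] with i hi
    have hlit : c ≤ literal (x i) (f i) := inf_le_right.trans (iInf_le _ i)
    cases hf : f i <;> rw [hf] at hlit
    · exact le_compl_comm.1 hlit
    · exact absurd hlit hi
  have hc : c ≤ cᶜ := inf_le_left.trans (limsup_le_of_le (h := hdisj))
  exact hca ((le_compl_self.1 hc).trans_le bot_le)

theorem IsOmegaTwoDistributive.convLs_isTopological (h : IsOmegaTwoDistributive B) :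
    (convLs B).IsTopological := by
  let := Topology.lower B
  have : Topology.IsLower B := ⟨rfl⟩
  refine ⟨Topology.lower B, funext fun x => Set.ext fun a =>
    ⟨tendsto_nhds_of_limsup_le, fun hlim => ?_⟩⟩
  calc limsup x atTop
    _ = ⨆ f : ℕ → Bool, limsup x atTop ⊓ ⨅ n, literal (x n) (f n) := by
      rw [← inf_iSup_eq, isOmegaTwoDistributive_iff_iSup_iInf_literal.1 h, inf_top_eq]
    _ ≤ a := iSup_le (limsup_inf_iInf_literal_le_of_tendsto_nhds hlim)

end LowerTopology

section DecisionTree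

theorem exists_log_two_eq_and_testBit_eq (g : ℕ → Bool) (k : ℕ) :
    ∃ n, Nat.log 2 n = k ∧ ∀ i < k, n.testBit i = g i := by
  have hlt := Nat.ofBits_lt_two_pow fun i : Fin k => g i
  refine ⟨2 ^ k + Nat.ofBits fun i : Fin k => g i, ?_, fun i hi => ?_⟩
  · rw [Nat.log_eq_iff (Or.inr ⟨one_lt_two, by positivity⟩), pow_succ]
    omega
  · rw [Nat.testBit_two_pow_add_gt hi, Nat.testBit_ofBits_lt _ _ hi]

theorem tendsto_log_atTop {b : ℕ} (hb : 1 < b) : Tendsto (Nat.log b) atTop atTop :=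
  tendsto_atTop.2 fun k =>
    (eventually_ge_atTop (b ^ k)).mono fun _ hn => Nat.le_log_of_pow_le hb hn

variable {B : Type*} [CompleteBooleanAlgebra B]

/-- The nodes of the binary tree of decisions about `a`, listed level by level. The node given by
the signs `g : k → 2` has index `2 ^ k + ∑ i < k, g i * 2 ^ i`, whose leading bit marks the
level. -/
def decisionTree (a : ℕ → B) (n : ℕ) : B := ⨅ i < Nat.log 2 n, literal (a i) (n.testBit i)

theorem limsup_decisionTree (a : ℕ → B) : limsup (decisionTree a) atTop = ⊤ := by
  rw [limsup_eq_iInf_iSup_of_nat, iInf_eq_top]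
  intro k
  rw [eq_top_iff, ← iSup_biInf_lt_literal a k]
  refine iSup_le fun g => ?_
  obtain ⟨n, rfl, hbits⟩ := exists_log_two_eq_and_testBit_eq g k
  exact le_iSup₂_of_le n (Nat.log_le_self 2 n)
    (iInf₂_mono fun i hi => (congrArg (literal (a i)) (hbits i hi)).ge)

theorem limsup_decisionTree_comp_le {ι : Type*} {l : Filter ι} (a : ℕ → B) {ns : ι → ℕ}
    {f : ℕ → Bool} (hns : Tendsto ns l atTop) (hf : Tendsto (fun k => (ns k).testBit) l (𝓝 f)) :
    limsup (decisionTree a ∘ ns) l ≤ ⨅ i, literal (a i) (f i) := by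
  refine le_iInf fun i => limsup_le_of_le (h := ?_)
  have hlevel : ∀ᶠ k in l, i < Nat.log 2 (ns k) :=
    ((tendsto_log_atTop one_lt_two).comp hns).eventually_gt_atTop i
  have hbit : ∀ᶠ k in l, (ns k).testBit i = f i := by
    simpa only [nhds_discrete, tendsto_pure] using tendsto_pi_nhds.1 hf i
  filter_upwards [hlevel, hbit] with k hk hki
  exact hki ▸ iInf₂_le i hk

theorem IsOmegaTwoDistributive.of_convLs_isTopological (h : (convLs B).IsTopological) :
    IsOmegaTwoDistributive B := by
  refine isOmegaTwoDistributive_iff_iSup_iInf_literal.2 fun a => ?_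
  set s := ⨆ f : ℕ → Bool, ⨅ n, literal (a n) (f n)
  suffices s ∈ convLs B (decisionTree a) from top_unique ((limsup_decisionTree a).ge.trans this)
  refine h.mem_of_forall_subseq fun ns hns => ?_
  obtain ⟨f, φ, hφ, hf⟩ := SeqCompactSpace.tendsto_subseq fun k => (ns k).testBit
  exact ⟨φ, (limsup_decisionTree_comp_le a (hns.comp hφ.tendsto_atTop) hf).trans
    (le_iSup (fun f : ℕ → Bool => ⨅ n, literal (a n) (f n)) f)⟩

end DecisionTree

theorem rank_pSet_ofNat (n : ℕ) : (PSet.ofNat.{u} n).rank = n := by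
  induction n with
  | zero => exact PSet.rank_empty
  | succ n ih => simp [PSet.ofNat, PSet.rank_insert, ih]

theorem pSet_ofNat_equiv_ofNat_iff {m n : ℕ} :
    (PSet.ofNat.{u} m).Equiv (PSet.ofNat.{u} n) ↔ m = n :=
  ⟨fun h => by simpa only [rank_pSet_ofNat, Nat.cast_inj] using PSet.rank_congr h,
    fun h => h ▸ PSet.Equiv.rfl⟩

namespace BName

variable {B : Type u} [CompleteBooleanAlgebra B]

section Equality

theorem eqVal_comm (x y : BName B) : eqVal x y = eqVal y x := by
  induction x generalizing y with
  | mk ι x b ih =>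
    obtain ⟨κ, y, c⟩ := y
    simp only [eqVal, ih]
    exact inf_comm _ _

theorem eqVal_eq_subsetVal_inf_subsetVal (x y : BName B) :
    eqVal x y = subsetVal x y ⊓ subsetVal y x := by
  obtain ⟨ι, x, b⟩ := x
  obtain ⟨κ, y, c⟩ := y
  simp only [eqVal, subsetVal, memVal, eqVal_comm (y _)]

theorem eqVal_refl (x : BName B) : eqVal x x = ⊤ := by
  induction x with
  | mk ι x b ih =>
    rw [eqVal_eq_subsetVal_inf_subsetVal, inf_idem]
    refine iInf_eq_top.2 fun i => himp_eq_top_iff.2 (le_iSup_of_le i ?_)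
    rw [ih, inf_top_eq]

theorem inf_subsetVal_mk_le {ι : Type u} (x : ι → BName B) (b : ι → B) (y : BName B) (i : ι) :
    b i ⊓ subsetVal (mk ι x b) y ≤ memVal (x i) y :=
  le_himp_iff'.1 (iInf_le _ i)

theorem subsetVal_trans_of_eqVal_trans {ι κ μ : Type u} {x : ι → BName B} {y : κ → BName B}
    {z : μ → BName B} (b : ι → B) (c : κ → B) (d : μ → B)
    (h : ∀ i j k, eqVal (x i) (y j) ⊓ eqVal (y j) (z k) ≤ eqVal (x i) (z k)) :
    subsetVal (mk ι x b) (mk κ y c) ⊓ subsetVal (mk κ y c) (mk μ z d) ≤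
      subsetVal (mk ι x b) (mk μ z d) := by
  refine le_iInf fun i => le_himp_iff'.2 ?_
  rw [← inf_assoc]
  refine (inf_le_inf_right _ (inf_subsetVal_mk_le x b _ i)).trans ?_
  simp only [memVal, iSup_inf_eq]
  refine iSup_le fun j => ?_
  rw [inf_right_comm]
  refine (inf_le_inf_right _ (inf_subsetVal_mk_le y c _ j)).trans ?_
  simp only [memVal, iSup_inf_eq]
  refine iSup_mono fun k => ?_
  rw [inf_assoc, inf_comm (eqVal _ _)]
  exact inf_le_inf_left _ (h i j k)

theorem eqVal_trans (x y z : BName B) : eqVal x y ⊓ eqVal y z ≤ eqVal x z := by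
  induction x generalizing y z with
  | mk ι x b ih =>
    obtain ⟨κ, y, c⟩ := y
    obtain ⟨μ, z, d⟩ := z
    have hxz := subsetVal_trans_of_eqVal_trans b c d fun i j k => ih i (y j) (z k)
    have hzx := subsetVal_trans_of_eqVal_trans (x := z) (y := y) (z := x) d c b fun k j i => by
      simpa only [eqVal_comm, inf_comm] using ih i (y j) (z k)
    simp only [eqVal_eq_subsetVal_inf_subsetVal]
    refine le_inf (le_trans ?_ hxz) (le_trans ?_ hzx)
    · exact inf_le_inf inf_le_left inf_le_left
    · exact inf_comm _ _ |>.le.trans (inf_le_inf inf_le_right inf_le_right)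

theorem eqVal_inf_memVal_le (x y z : BName B) : eqVal x y ⊓ memVal y z ≤ memVal x z := by
  obtain ⟨κ, z, c⟩ := z
  simp only [memVal, inf_iSup_eq]
  refine iSup_mono fun j => ?_
  rw [inf_left_comm]
  exact inf_le_inf_left _ (eqVal_trans x y (z j))

theorem subsetVal_inf_memVal_le (x y z : BName B) :
    subsetVal x y ⊓ memVal z x ≤ memVal z y := by
  obtain ⟨ι, x, b⟩ := x
  simp only [memVal, inf_iSup_eq]
  refine iSup_le fun i => ?_
  rw [inf_left_comm, ← inf_assoc, inf_comm]
  exact (inf_le_inf_left _ (inf_subsetVal_mk_le x b y i)).trans (eqVal_inf_memVal_le z (x i) y)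

theorem le_subsetVal_iff {a : B} {x y : BName B} :
    a ≤ subsetVal x y ↔ ∀ z, a ⊓ memVal z x ≤ memVal z y := by
  refine ⟨fun h z => (inf_le_inf_right _ h).trans (subsetVal_inf_memVal_le x y z), fun h => ?_⟩
  obtain ⟨ι, x, b⟩ := x
  refine le_iInf fun i => le_himp_iff.2 ((inf_le_inf_left a ?_).trans (h (x i)))
  exact le_iSup_of_le i (by rw [eqVal_refl, inf_top_eq])

end Equality

section CheckNames

theorem eqVal_check_of_equiv {p q : PSet.{u}} (h : p.Equiv q) :
    eqVal (check p : BName B) (check q) = ⊤ := by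
  induction p generalizing q with
  | mk α A ih =>
    obtain ⟨β, C⟩ := q
    simp only [check, eqVal, top_himp, top_inf_eq, inf_eq_top_iff, iInf_eq_top]
    refine ⟨fun i => ?_, fun j => ?_⟩
    · obtain ⟨j, hj⟩ := h.1 i
      exact top_unique (le_iSup_of_le j (ih i hj).ge)
    · obtain ⟨i, hi⟩ := h.2 j
      exact top_unique (le_iSup_of_le i (ih i hi).ge)

theorem eqVal_check_of_not_equiv {p q : PSet.{u}} (h : ¬ p.Equiv q) :
    eqVal (check p : BName B) (check q) = ⊥ := by
  induction p generalizing q with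
  | mk α A ih =>
    obtain ⟨β, C⟩ := q
    simp only [check, eqVal, top_himp, top_inf_eq]
    rw [PSet.equiv_iff, not_and_or] at h
    push Not at h
    rcases h with ⟨i, hi⟩ | ⟨j, hj⟩
    · exact bot_unique (inf_le_left.trans (iInf_le_of_le i (iSup_le fun j => (ih i (hi j)).le)))
    · exact bot_unique (inf_le_right.trans (iInf_le_of_le j (iSup_le fun i => (ih i (hj i)).le)))

theorem memVal_check (x : BName B) (q : PSet.{u}) :
    memVal x (check q) = ⨆ j, eqVal x (check (q.Func j)) := by
  obtain ⟨β, C⟩ := q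
  simp only [check, memVal, top_inf_eq]
  rfl

theorem memVal_check_omega (x : BName B) :
    memVal x (check PSet.omega) = ⨆ n : ℕ, eqVal x (check (PSet.ofNat n)) :=
  (memVal_check x PSet.omega).trans (iSup_ulift _)

theorem memVal_check_of_mem {p q : PSet.{u}} (h : p ∈ q) :
    memVal (check p : BName B) (check q) = ⊤ := by
  obtain ⟨j, hj⟩ := PSet.mem_def.1 h
  rw [memVal_check]
  exact top_unique (le_iSup_of_le j (eqVal_check_of_equiv hj).ge)

theorem memVal_check_of_notMem {p q : PSet.{u}} (h : p ∉ q) :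
    memVal (check p : BName B) (check q) = ⊥ := by
  rw [memVal_check]
  exact iSup_eq_bot.2 fun j => eqVal_check_of_not_equiv fun hj => h (PSet.mem_def.2 ⟨j, hj⟩)

theorem eqVal_check_le_literal_memVal (x : BName B) (p q : PSet.{u}) [Decidable (p ∈ q)] :
    eqVal x (check q) ≤ literal (memVal (check p) x) (decide (p ∈ q)) := by
  rw [eqVal_eq_subsetVal_inf_subsetVal]
  by_cases hpq : p ∈ q
  · have hmem := subsetVal_inf_memVal_le (check q) x (check p)
    rw [memVal_check_of_mem hpq, inf_top_eq] at hmem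
    rw [decide_eq_true hpq]
    exact inf_le_right.trans hmem
  · have hnotMem := subsetVal_inf_memVal_le x (check q) (check p)
    rw [memVal_check_of_notMem hpq] at hnotMem
    rw [decide_eq_false hpq]
    exact inf_le_left.trans (le_compl_iff_disjoint_right.2 (disjoint_iff_inf_le.2 hnotMem))

end CheckNames

section Reals

/-- The name of the subset of `ω` that contains `n` with value `a n`. -/
def ofSeq (a : ℕ → B) : BName B :=
  ⟨ULift.{u} ℕ, fun n => check (PSet.ofNat n.down), fun n => a n.down⟩

theorem memVal_check_ofNat_ofSeq (a : ℕ → B) (n : ℕ) :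
    memVal (check (PSet.ofNat n)) (ofSeq a) = a n := by
  refine le_antisymm (iSup_le fun m => ?_) (le_iSup_of_le (ULift.up n) ?_)
  · by_cases hmn : n = m.down
    · exact hmn ▸ inf_le_left
    · rw [eqVal_check_of_not_equiv (mt pSet_ofNat_equiv_ofNat_iff.1 hmn), inf_bot_eq]
      exact bot_le
  · rw [eqVal_refl, inf_top_eq]

theorem subsetVal_ofSeq_check_omega (a : ℕ → B) :
    subsetVal (ofSeq a) (check PSet.omega) = ⊤ := by
  refine iInf_eq_top.2 fun n => himp_eq_top_iff.2 (le_top.trans ?_)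
  exact (memVal_check_of_mem (q := PSet.omega) ⟨n, PSet.Equiv.rfl⟩).ge

/-- The subset of `ω` with characteristic function `f`, as a set of the ground universe. -/
def groundSubset (f : ℕ → Bool) : PSet.{u} :=
  ⟨ULift.{u} {n // f n = true}, fun n => PSet.ofNat n.down.1⟩

theorem memVal_inf_iInf_literal_le (x z : BName B) (f : ℕ → Bool) :
    memVal z x ⊓ memVal z (check PSet.omega) ⊓
        ⨅ n, literal (memVal (check (PSet.ofNat n)) x) (f n) ≤
      memVal z (check (groundSubset f)) := by
  rw [memVal_check_omega, inf_iSup_eq, iSup_inf_eq]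
  refine iSup_le fun n => ?_
  cases hf : f n
  · have hmem : memVal z x ⊓ eqVal z (check (PSet.ofNat n)) ≤ memVal (check (PSet.ofNat n)) x := by
      rw [inf_comm, eqVal_comm]
      exact eqVal_inf_memVal_le _ z x
    have hlit := iInf_le (fun n => literal (memVal (check (PSet.ofNat n)) x) (f n)) n
    rw [hf] at hlit
    exact (inf_le_inf hmem hlit).trans ((inf_compl_self _).le.trans bot_le)
  · have hmem : PSet.ofNat n ∈ groundSubset f := ⟨⟨n, hf⟩, PSet.Equiv.rfl⟩
    have hsubst := eqVal_inf_memVal_le z (check (PSet.ofNat n)) (check (groundSubset f))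
    rw [memVal_check_of_mem hmem, inf_top_eq] at hsubst
    exact inf_le_left.trans (inf_le_right.trans hsubst)

theorem subsetVal_inf_iInf_literal_le_subsetVal (x : BName B) (f : ℕ → Bool) :
    (subsetVal x (check PSet.omega) ⊓ ⨅ n, literal (memVal (check (PSet.ofNat n)) x) (f n)) ≤
      subsetVal x (check (groundSubset f)) := by
  refine le_subsetVal_iff.2 fun z => le_trans ?_ (memVal_inf_iInf_literal_le x z f)
  rw [inf_right_comm]
  exact inf_le_inf_right _ (le_inf inf_le_right (subsetVal_inf_memVal_le x (check PSet.omega) z))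

theorem iInf_literal_le_subsetVal (x : BName B) (f : ℕ → Bool) :
    ⨅ n, literal (memVal (check (PSet.ofNat n)) x) (f n) ≤
      subsetVal (check (groundSubset f)) x := by
  refine le_iInf fun n => iInf_le_of_le n.down.1 ?_
  rw [n.down.2, top_himp]
  rfl

theorem subsetVal_inf_iInf_literal_le_eqVal (x : BName B) (f : ℕ → Bool) :
    (subsetVal x (check PSet.omega) ⊓ ⨅ n, literal (memVal (check (PSet.ofNat n)) x) (f n)) ≤
      eqVal x (check (groundSubset f)) := by
  rw [eqVal_eq_subsetVal_inf_subsetVal]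
  exact le_inf (subsetVal_inf_iInf_literal_le_subsetVal x f)
    (inf_le_right.trans (iInf_literal_le_subsetVal x f))

end Reals

end BName

section Forcing

variable {B : Type u} [CompleteBooleanAlgebra B]

theorem IsOmegaTwoDistributive.forcingAddsNoNewReals (h : IsOmegaTwoDistributive B) :
    ForcingAddsNoNewReals B := by
  refine iInf_eq_top.2 fun x => himp_eq_top_iff.2 ?_
  have htop := isOmegaTwoDistributive_iff_iSup_iInf_literal.1 h fun n =>
    BName.memVal (BName.check (PSet.ofNat n)) x
  rw [← inf_top_eq (BName.subsetVal _ _), ← htop, inf_iSup_eq]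
  exact iSup_le fun f => (BName.subsetVal_inf_iInf_literal_le_eqVal x f).trans
    (le_iSup (fun p => BName.eqVal x (BName.check p)) (BName.groundSubset f))

theorem IsOmegaTwoDistributive.of_forcingAddsNoNewReals (h : ForcingAddsNoNewReals B) :
    IsOmegaTwoDistributive B := by
  classical
  refine isOmegaTwoDistributive_iff_iSup_iInf_literal.2 fun a => ?_
  have hground : BName.groundVal (BName.ofSeq a) = ⊤ := by
    simpa only [BName.subsetVal_ofSeq_check_omega, top_himp]
      using iInf_eq_top.1 h (BName.ofSeq a)
  refine top_unique (hground.ge.trans (iSup_le fun p => ?_))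
  refine le_iSup_of_le (fun n => decide (PSet.ofNat n ∈ p)) (le_iInf fun n => ?_)
  simpa only [BName.memVal_check_ofNat_ofSeq] using
    BName.eqVal_check_le_literal_memVal (BName.ofSeq a) (PSet.ofNat n) p

end Forcing

theorem mainTheorem1 (B : Type u) [CompleteBooleanAlgebra B] :
    List.TFAE
      [ (convLs B).IsTopological,
        (convLi B).IsTopological,
        IsOmegaTwoDistributive B,
        ForcingAddsNoNewReals B ] := by
  tfae_have 1 ↔ 2 := convLs_isTopological_iff_convLi_isTopological
  tfae_have 1 → 3 := .of_convLs_isTopological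
  tfae_have 3 → 1 := IsOmegaTwoDistributive.convLs_isTopological
  tfae_have 3 → 4 := IsOmegaTwoDistributive.forcingAddsNoNewReals
  tfae_have 4 → 3 := .of_forcingAddsNoNewReals
  tfae_finish
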